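/- A $C^\infty$-ring is a set $A$ with an operation $A^n\to A$ for every $n\ge 0$ and every smooth function $f\colon\mathbb R^n\to\mathbb R$, compatible with coordinate projections and with composition of smooth maps (equivalently, a product-preserving functor to sets on the category of the spaces $\mathbb R^n$ and smooth maps); a morphism of $C^\infty$-rings is a map commuting with all these operations. Every $C^\infty$-ring is in particular a commutative ring (an $\mathbb R$-algebra), and for every ideal $I$ of this ring the quotient $A/I$ is again a $C^\infty$-ring. For an element $b$ of a $C^\infty$-ring $B$ let $B\{b^{-1}\}$ be the $C^\infty$-ring obtained from $B$ by universally inverting $b$ in the category of $C^\infty$-rings. The $\infty$-radical of an ideal $I\le A$ is $$\sqrt[\infty]{I}:=\{a\in A\mid (A/I)\{a^{-1}\}\cong 0\}.$$ Let $\phi\colon A\to A'$ be a surjective morphism of $C^\infty$-rings, and let $$\mathfrak g_\phi:=\{a\in A\mid \exists\, b\in A\ \text{such that}\ ab=0\ \text{and}\ \phi(b)\ \text{is invertible in}\ A'\}$$ be the ideal of elements with vanishing germ at $\operatorname{Spec}A'$. Then $$\mathfrak g_\phi\ \subseteq\ \bigcap_{I\le A,\ \sqrt[\infty]{I}=\sqrt[\infty]{\operatorname{Ker}\phi}}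 I .$$ Suppose in addition that $A$ is finitely generated (there is a surjective morphism of $C^\infty$-rings $C^\infty(\mathbb R^n)\to A$ for some $n\ge 0$) and point-determined (an element $a\in A$ with $p(a)=0$ for all morphisms of $C^\infty$-rings $p\colon A\to\mathbb R$ is $0$). Then this inclusion is an equality. -/

import Mathlib

open scoped ContDiff

universe u v

namespace CInfty

/-! ### The rings `C^∞(ℝⁿ)` -/

/-- The ring `C^∞(ℝⁿ)` of smooth real functions on `ℝⁿ`. -/
def smoothSubring (n : ℕ) : Subring ((Fin n → ℝ) → ℝ) where
  carrier := {f | ContDiff ℝ ∞ f}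
  mul_mem' := fun {f g} (hf : ContDiff ℝ ∞ f) (hg : ContDiff ℝ ∞ g) => hf.mul hg
  one_mem' := (contDiff_const : ContDiff ℝ ∞ fun _ : Fin n → ℝ => (1 : ℝ))
  add_mem' := fun {f g} (hf : ContDiff ℝ ∞ f) (hg : ContDiff ℝ ∞ g) => hf.add hg
  zero_mem' := (contDiff_const : ContDiff ℝ ∞ fun _ : Fin n → ℝ => (0 : ℝ))
  neg_mem' := fun {f} (hf : ContDiff ℝ ∞ f) => hf.neg

/-- Smooth functions `ℝⁿ → ℝ`, as a commutative ring. -/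
abbrev SmoothFun (n : ℕ) : Type := smoothSubring n

namespace SmoothFun

theorem contDiff {n : ℕ} (f : SmoothFun n) : ContDiff ℝ ∞ f.1 := f.2

/-- The `i`-th coordinate function on `ℝⁿ`. -/
def coord {n : ℕ} (i : Fin n) : SmoothFun n :=
  ⟨fun x => x i, (contDiff_apply ℝ ℝ i : ContDiff ℝ ∞ fun x : Fin n → ℝ => x i)⟩

/-- The composite `x ↦ f (g₁ x, …, gₙ x)` of smooth maps `ℝᵐ → ℝⁿ → ℝ`. -/
def comp {n m : ℕ} (f : SmoothFun n) (g : Fin n → SmoothFun m) : SmoothFun m :=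
  ⟨fun x => f.1 (fun i => (g i).1 x), f.contDiff.comp (contDiff_pi.2 fun i => (g i).contDiff)⟩

/-- Addition `ℝ² → ℝ` as a smooth function. -/
def addFun : SmoothFun 2 := coord 0 + coord 1

/-- Multiplication `ℝ² → ℝ` as a smooth function. -/
def mulFun : SmoothFun 2 := coord 0 * coord 1

theorem addFun_comp {m : ℕ} (f g : SmoothFun m) : addFun.comp ![f, g] = f + g := rfl

theorem mulFun_comp {m : ℕ} (f g : SmoothFun m) : mulFun.comp ![f, g] = f * g := rfl

end SmoothFun

open SmoothFun

/-! ### `C^∞`-rings and their morphisms -/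

/-- A `C^∞`-ring: a set with an operation `Aⁿ → A` for every smooth function `ℝⁿ → ℝ`, compatibly
with projections and composition (equivalently, a product preserving functor on the category of
the spaces `ℝⁿ` and smooth maps). The underlying commutative ring, whose operations are those
given by the smooth functions `x + y` and `x y`, is carried along as data;
`CInftyRing.ofOps` shows that it is no additional structure. -/
class CInftyRing (A : Type u) extends CommRing A where
  /-- The operation of a smooth function. -/
  op : ∀ {n : ℕ}, SmoothFun n → (Fin n → A) → A
  op_coord : ∀ {n : ℕ} (i : Fin n) (a : Fin n → A), op (coord i) a = a i
  op_comp : ∀ {n m : ℕ} (f : SmoothFun n) (g : Fin n → SmoothFun m) (a : Fin m → A),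
    op (f.comp g) a = op f (fun i => op (g i) a)
  op_addFun : ∀ a b : A, op addFun ![a, b] = a + b
  op_mulFun : ∀ a b : A, op mulFun ![a, b] = a * b

attribute [instance 100] CInftyRing.toCommRing

/-- A morphism of `C^∞`-rings: a map commuting with all operations. (That it is a ring
homomorphism is a special case, and is recorded for convenience.) -/
structure CInftyHom (A : Type u) (B : Type v) [CInftyRing A] [CInftyRing B] extends A →+* B where
  map_op : ∀ {n : ℕ} (f : SmoothFun n) (a : Fin n → A),
    toFun (CInftyRing.op f a) = CInftyRing.op f (fun i => toFun (a i))

namespace CInftyRing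

theorem ofOps_add {A : Type u} (op : ∀ {n : ℕ}, SmoothFun n → (Fin n → A) → A)
    (op_comp : ∀ {n m : ℕ} (f : SmoothFun n) (g : Fin n → SmoothFun m) (a : Fin m → A),
      op (f.comp g) a = op f (fun i => op (g i) a))
    {n : ℕ} (h : SmoothFun 2) (f g : SmoothFun n) (a : Fin n → A) :
    op h ![op f a, op g a] = op (h.comp ![f, g]) a := by
  rw [op_comp]
  congr 1
  funext i
  fin_cases i <;> rfl

/-- Any system of operations compatible with projections and composition makes a set a
`C^∞`-ring. -/
abbrev ofOps {A : Type u} (op : ∀ {n : ℕ}, SmoothFun n → (Fin n → A) → A)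
    (op_coord : ∀ {n : ℕ} (i : Fin n) (a : Fin n → A), op (coord i) a = a i)
    (op_comp : ∀ {n m : ℕ} (f : SmoothFun n) (g : Fin n → SmoothFun m) (a : Fin m → A),
      op (f.comp g) a = op f (fun i => op (g i) a)) : CInftyRing A :=
  have key : ∀ {n : ℕ} (h : SmoothFun 2) (f g : SmoothFun n) (a : Fin n → A),
      op h ![op f a, op g a] = op (h.comp ![f, g]) a :=
    fun h f g a => ofOps_add op op_comp h f g a
  have key0 : ∀ {n : ℕ} (c : SmoothFun 0) (a : Fin n → A),
      op c ![] = op (c.comp ![]) a := by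
    intro n c a
    rw [op_comp]
    congr 1
    exact Subsingleton.elim _ _
  have key1 : ∀ {n : ℕ} (c : SmoothFun 1) (f : SmoothFun n) (a : Fin n → A),
      op c ![op f a] = op (c.comp ![f]) a := by
    intro n c f a
    rw [op_comp]
    congr 1
    funext i
    fin_cases i; rfl
  letI : Add A := ⟨fun a b => op addFun ![a, b]⟩
  letI : Mul A := ⟨fun a b => op mulFun ![a, b]⟩
  letI : Zero A := ⟨op (0 : SmoothFun 0) ![]⟩
  letI : One A := ⟨op (1 : SmoothFun 0) ![]⟩
  letI : Neg A := ⟨fun a => op (-coord 0 : SmoothFun 1) ![a]⟩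
  have hadd : ∀ {n : ℕ} (f g : SmoothFun n) (a : Fin n → A), op f a + op g a = op (f + g) a :=
    fun f g a => key addFun f g a
  have hmul : ∀ {n : ℕ} (f g : SmoothFun n) (a : Fin n → A), op f a * op g a = op (f * g) a :=
    fun f g a => key mulFun f g a
  have hzero : ∀ {n : ℕ} (a : Fin n → A), 0 = op (0 : SmoothFun n) a := fun a => key0 0 a
  have hone : ∀ {n : ℕ} (a : Fin n → A), 1 = op (1 : SmoothFun n) a := fun a => key0 1 a
  have hneg : ∀ {n : ℕ} (f : SmoothFun n) (a : Fin n → A), -op f a = op (-f) a :=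
    fun f a => key1 (-coord 0) f a
  have red : ∀ x y z : A, ∃ (a : Fin 3 → A) (f g h : SmoothFun 3),
      x = op f a ∧ y = op g a ∧ z = op h a := fun x y z =>
    ⟨![x, y, z], coord 0, coord 1, coord 2,
      (op_coord 0 ![x, y, z]).symm, (op_coord 1 ![x, y, z]).symm, (op_coord 2 ![x, y, z]).symm⟩
  { toCommRing := CommRing.ofMinimalAxioms
      (by
        intro x y z
        obtain ⟨a, f, g, h, rfl, rfl, rfl⟩ := red x y z
        simp only [hadd, add_assoc])
      (by
        intro x
        obtain ⟨a, f, g, h, rfl, -, -⟩ := red x x x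
        rw [hzero a, hadd, zero_add])
      (by
        intro x
        obtain ⟨a, f, g, h, rfl, -, -⟩ := red x x x
        rw [hneg, hadd, neg_add_cancel, hzero a])
      (by
        intro x y z
        obtain ⟨a, f, g, h, rfl, rfl, rfl⟩ := red x y z
        simp only [hmul, mul_assoc])
      (by
        intro x y
        obtain ⟨a, f, g, h, rfl, rfl, -⟩ := red x y y
        rw [hmul, hmul, mul_comm])
      (by
        intro x
        obtain ⟨a, f, g, h, rfl, -, -⟩ := red x x x
        rw [hone a, hmul, one_mul])
      (by
        intro x y z
        obtain ⟨a, f, g, h, rfl, rfl, rfl⟩ := red x y z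
        simp only [hmul, hadd, mul_add])
    op := op
    op_coord := op_coord
    op_comp := op_comp
    op_addFun := fun _ _ => rfl
    op_mulFun := fun _ _ => rfl }

section basic

variable {A : Type u} [CInftyRing A]

theorem op_add {n : ℕ} (f g : SmoothFun n) (a : Fin n → A) :
    op (f + g) a = op f a + op g a := by
  rw [← op_addFun, ofOps_add op op_comp, addFun_comp]

theorem op_mul {n : ℕ} (f g : SmoothFun n) (a : Fin n → A) :
    op (f * g) a = op f a * op g a := by
  rw [← op_mulFun, ofOps_add op op_comp, mulFun_comp]

theorem op_one {n : ℕ} (a : Fin n → A) : op (1 : SmoothFun n) a = 1 := by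
  have h0 : ∀ {m : ℕ} (b : Fin m → A), op (1 : SmoothFun m) b = op (1 : SmoothFun 0) ![] := by
    intro m b
    have := op_comp (1 : SmoothFun 0) (![] : Fin 0 → SmoothFun m) b
    rw [Subsingleton.elim (fun i => op ((![] : Fin 0 → SmoothFun m) i) b) ![]] at this
    exact this
  have h1 : ∀ x : A, op (1 : SmoothFun n) a * x = x := by
    intro x
    have := op_mul (1 : SmoothFun 1) (coord 0) ![x]
    rw [one_mul, op_coord, h0 ![x], ← h0 a] at this
    exact this.symm
  simpa using h1 1

/-- Applying smooth functions to a fixed tuple of elements is a ring homomorphism. -/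
def opHom {n : ℕ} (a : Fin n → A) : SmoothFun n →+* A :=
  RingHom.mk' ⟨⟨fun f => op f a, op_one a⟩, fun f g => op_mul f g a⟩ (fun f g => op_add f g a)

theorem opHom_apply {n : ℕ} (a : Fin n → A) (f : SmoothFun n) : opHom a f = op f a := rfl

end basic

end CInftyRing

open CInftyRing

/-! ### The examples `ℝ` and `C^∞(ℝⁿ)` -/

noncomputable instance instReal : CInftyRing ℝ where
  op f a := f.1 a
  op_coord _ _ := rfl
  op_comp _ _ _ := rfl
  op_addFun _ _ := rfl
  op_mulFun _ _ := rfl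

noncomputable instance instSmoothFun (m : ℕ) : CInftyRing (SmoothFun m) where
  op f a := f.comp a
  op_coord _ _ := rfl
  op_comp _ _ _ := rfl
  op_addFun _ _ := rfl
  op_mulFun _ _ := rfl

/-! ### Quotients by ideals

By Hadamard's lemma every ideal of the underlying ring is compatible with all smooth
operations. -/

section hadamard

open MeasureTheory Convolution Set

theorem contDiff_integral01 {E : Type} [NormedAddCommGroup E] [NormedSpace ℝ E]
    (h : E × ℝ → ℝ) (hh : ContDiff ℝ ∞ h) :
    ContDiff ℝ ∞ (fun x => ∫ t in (0:ℝ)..1, h (x, t)) := by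
  let χ : ContDiffBump (0 : ℝ) := ⟨2, 3, by norm_num, by norm_num⟩
  have key := contDiffOn_convolution_right_with_param_comp (n := ⊤) (ContinuousLinearMap.mul ℝ ℝ)
    (s := (univ : Set E)) (v := fun _ => (0:ℝ)) contDiffOn_const
    (f := indicator (Ioc (0:ℝ) 1) 1) (g := fun x s => χ s * h (x, -s))
    (k := Metric.closedBall 0 3) (μ := volume) isOpen_univ (isCompact_closedBall _ _)
    (by
      intro p x _ hx
      simp only [Metric.mem_closedBall, not_le] at hx
      simp [χ.zero_of_le_dist hx.le])
    ((integrable_indicator_iff measurableSet_Ioc).2 (integrableOn_const (by simp))).locallyIntegrable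
    (by
      apply ContDiff.contDiffOn
      have h1 : ContDiff ℝ ∞ (fun q : E × ℝ => χ q.2) := χ.contDiff.comp contDiff_snd
      have h2 : ContDiff ℝ ∞ (fun q : E × ℝ => h (q.1, -q.2)) :=
        hh.comp (contDiff_fst.prodMk contDiff_snd.neg)
      exact h1.mul h2)
  rw [contDiffOn_univ] at key
  convert key using 2 with x
  rw [intervalIntegral.integral_of_le zero_le_one, ← integral_indicator measurableSet_Ioc,
    convolution_def]
  congr 1
  funext t
  by_cases ht : t ∈ Ioc (0:ℝ) 1
  · have : χ (0 - t) = 1 := by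
      apply χ.one_of_mem_closedBall
      have := ht.1; have := ht.2
      simp [χ, abs_le]; constructor <;> linarith
    simp [ht] at *
    simp [this]
  · simp [ht]

theorem hadamard {n : ℕ} (f : (Fin n → ℝ) → ℝ) (hf : ContDiff ℝ ∞ f) :
    ∃ g : Fin n → (Fin (n + n) → ℝ) → ℝ, (∀ i, ContDiff ℝ ∞ (g i)) ∧
      ∀ x y : Fin n → ℝ, f x - f y = ∑ i, (x i - y i) * g i (Fin.append x y) := by
  let c : (Fin (n + n) → ℝ) × ℝ → (Fin n → ℝ) := fun q i =>
    q.1 (Fin.natAdd n i) + q.2 * (q.1 (Fin.castAdd n i) - q.1 (Fin.natAdd n i))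
  have hc : ContDiff ℝ ∞ c := by
    rw [contDiff_pi]; intro i; fun_prop
  have hd : ContDiff ℝ ∞ (fderiv ℝ f) := hf.fderiv_right (by simp)
  refine ⟨fun i z => ∫ t in (0:ℝ)..1, fderiv ℝ f (c (z, t)) (Pi.single i 1), fun i => ?_, ?_⟩
  · exact contDiff_integral01 (fun q => fderiv ℝ f (c q) (Pi.single i 1))
      ((hd.comp hc).clm_apply contDiff_const)
  · intro x y
    have hcont : ∀ v : Fin n → ℝ, Continuous fun t : ℝ => fderiv ℝ f (c (Fin.append x y, t)) v := by
      intro v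
      have := ((hd.comp hc).clm_apply (contDiff_const (c := v))).continuous
      exact this.comp (Continuous.prodMk_right _)
    have hder : ∀ t : ℝ, HasDerivAt (fun t => f (c (Fin.append x y, t)))
        (fderiv ℝ f (c (Fin.append x y, t)) (x - y)) t := by
      intro t
      have h1 : HasDerivAt (fun t => c (Fin.append x y, t)) (x - y) t := by
        rw [hasDerivAt_pi]
        intro i
        simp only [c, Fin.append_left, Fin.append_right]
        simpa using ((hasDerivAt_id t).mul_const (x i - y i)).const_add (y i)
      exact (hf.differentiable (by simp) _).hasFDerivAt.comp_hasDerivAt t h1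
    have hint := intervalIntegral.integral_eq_sub_of_hasDerivAt (a := 0) (b := 1)
      (fun t _ => hder t) ((hcont _).intervalIntegrable _ _)
    have e1 : c (Fin.append x y, 1) = x := by funext i; simp [c]
    have e0 : c (Fin.append x y, 0) = y := by
      funext i; simp only [c, Fin.append_right]; simp
    rw [e1, e0] at hint
    rw [← hint]
    simp_rw [← intervalIntegral.integral_const_mul]
    rw [← intervalIntegral.integral_finsetSum
      (fun i _ => ((hcont _).intervalIntegrable _ _).const_mul _)]
    congr 1
    funext t
    conv_lhs => rw [pi_eq_sum_univ' (x - y)]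
    simp [map_sum]

end hadamard

section quotient

variable {A : Type u} [CInftyRing A]

theorem op_sub_mem (I : Ideal A) {n : ℕ} (f : SmoothFun n) (a b : Fin n → A)
    (h : ∀ i, a i - b i ∈ I) : op f a - op f b ∈ I := by
  obtain ⟨g, hg, hfg⟩ := hadamard f.1 f.contDiff
  have key : f.comp (fun i => coord (Fin.castAdd n i)) - f.comp (fun i => coord (Fin.natAdd n i)) =
      ∑ i, (coord (Fin.castAdd n i) - coord (Fin.natAdd n i)) * (⟨g i, hg i⟩ : SmoothFun (n + n)) := by
    apply Subtype.ext
    funext z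
    have hz : z = Fin.append (fun i => z (Fin.castAdd n i)) (fun i => z (Fin.natAdd n i)) :=
      (Fin.append_castAdd_natAdd (f := z)).symm
    have := hfg (fun i => z (Fin.castAdd n i)) (fun i => z (Fin.natAdd n i))
    rw [← hz] at this
    simpa [comp, coord] using this
  have key2 := congrArg (opHom (Fin.append a b)) key
  simp only [map_sub, map_sum, map_mul, opHom_apply, op_comp, op_coord, Fin.append_left,
    Fin.append_right] at key2
  rw [key2]
  exact I.sum_mem fun i _ => I.mul_mem_right _ (h i)

/-- The quotient of a `C^∞`-ring by an ideal: the operations are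
`f ([a₁], …, [aₙ]) = [f (a₁, …, aₙ)]`, see `op_mk`. -/
noncomputable def quotientOp (I : Ideal A) {n : ℕ} (f : SmoothFun n) (a : Fin n → A ⧸ I) : A ⧸ I :=
  Ideal.Quotient.mk I (op f fun i => Function.surjInv Ideal.Quotient.mk_surjective (a i))

theorem quotientOp_mk (I : Ideal A) {n : ℕ} (f : SmoothFun n) (a : Fin n → A) :
    quotientOp I f (fun i => Ideal.Quotient.mk I (a i)) = Ideal.Quotient.mk I (op f a) := by
  rw [quotientOp, Ideal.Quotient.eq]
  apply op_sub_mem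
  intro i
  rw [← Ideal.Quotient.eq]
  exact Function.surjInv_eq _ _

theorem exists_rep (I : Ideal A) {n : ℕ} (a : Fin n → A ⧸ I) :
    ∃ b : Fin n → A, a = fun i => Ideal.Quotient.mk I (b i) :=
  ⟨fun i => Function.surjInv Ideal.Quotient.mk_surjective (a i),
    funext fun _ => (Function.surjInv_eq _ _).symm⟩

theorem quotientOp_mk_two (I : Ideal A) (f : SmoothFun 2) (a b : A) :
    quotientOp I f ![Ideal.Quotient.mk I a, Ideal.Quotient.mk I b] =
      Ideal.Quotient.mk I (op f ![a, b]) := by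
  rw [← quotientOp_mk]
  congr 1
  funext i
  fin_cases i <;> rfl

noncomputable instance instQuotient (I : Ideal A) : CInftyRing (A ⧸ I) where
  op f a := quotientOp I f a
  op_coord i a := by
    obtain ⟨b, rfl⟩ := exists_rep I a
    rw [quotientOp_mk, op_coord]
  op_comp f g a := by
    obtain ⟨b, rfl⟩ := exists_rep I a
    simp only [quotientOp_mk, op_comp]
  op_addFun a b := by
    obtain ⟨a, rfl⟩ := Ideal.Quotient.mk_surjective a
    obtain ⟨b, rfl⟩ := Ideal.Quotient.mk_surjective b
    rw [quotientOp_mk_two, op_addFun, map_add]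
  op_mulFun a b := by
    obtain ⟨a, rfl⟩ := Ideal.Quotient.mk_surjective a
    obtain ⟨b, rfl⟩ := Ideal.Quotient.mk_surjective b
    rw [quotientOp_mk_two, op_mulFun, map_mul]

theorem op_mk (I : Ideal A) {n : ℕ} (f : SmoothFun n) (a : Fin n → A) :
    op f (fun i => Ideal.Quotient.mk I (a i)) = Ideal.Quotient.mk I (op f a) :=
  quotientOp_mk I f a

end quotient

/-! ### Inverting an element in the category of `C^∞`-rings -/

/-- Formal expressions in the elements of `B`, one further symbol `inv`, and the operations of
`C^∞`-rings. -/
inductive InvTerm (B : Type u) : Type u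
  | of : B → InvTerm B
  | inv : InvTerm B
  | op : {n : ℕ} → SmoothFun n → (Fin n → InvTerm B) → InvTerm B

/-- The congruence on formal expressions generated by the laws of `C^∞`-rings, the operations
of `B`, and the relation `b * inv = 1`. -/
inductive InvRel {B : Type u} [CInftyRing B] (b : B) : InvTerm B → InvTerm B → Prop
  | refl (s : InvTerm B) : InvRel b s s
  | symm {s t : InvTerm B} : InvRel b s t → InvRel b t s
  | trans {s t r : InvTerm B} : InvRel b s t → InvRel b t r → InvRel b s r
  | congr {n : ℕ} (f : SmoothFun n) {s t : Fin n → InvTerm B} :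
      (∀ i, InvRel b (s i) (t i)) → InvRel b (.op f s) (.op f t)
  | coord {n : ℕ} (i : Fin n) (s : Fin n → InvTerm B) : InvRel b (.op (coord i) s) (s i)
  | comp {n m : ℕ} (f : SmoothFun n) (g : Fin n → SmoothFun m) (s : Fin m → InvTerm B) :
      InvRel b (.op (f.comp g) s) (.op f fun i => .op (g i) s)
  | of_op {n : ℕ} (f : SmoothFun n) (a : Fin n → B) :
      InvRel b (.of (op f a)) (.op f fun i => .of (a i))
  | mul_inv : InvRel b (.op mulFun ![.of b, .inv]) (.of 1)

/-- The congruence `InvRel b` as a setoid. -/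
def invSetoid {B : Type u} [CInftyRing B] (b : B) : Setoid (InvTerm B) :=
  ⟨InvRel b, ⟨.refl, .symm, .trans⟩⟩

/-- The `C^∞`-ring `B{b⁻¹}` obtained from `B` by freely inverting `b` in the category of
`C^∞`-rings; its universal property is `Inverted.existsUnique_lift`. -/
def Inverted {B : Type u} [CInftyRing B] (b : B) : Type u := Quotient (invSetoid b)

namespace Inverted

variable {B : Type u} [CInftyRing B] (b : B)

/-- The class of a formal expression. -/
def mk (s : InvTerm B) : Inverted b := Quotient.mk (invSetoid b) s

theorem mk_eq {s t : InvTerm B} (h : InvRel b s t) : mk b s = mk b t :=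
  Quotient.sound (s := invSetoid b) h

theorem mk_exact {s t : InvTerm B} (h : mk b s = mk b t) : InvRel b s t :=
  Quotient.exact (s := invSetoid b) h

theorem mk_surjective : Function.Surjective (mk b) := Quotient.mk_surjective

/-- The operations on classes of formal expressions. -/
noncomputable def opInv {n : ℕ} (f : SmoothFun n) (q : Fin n → Inverted b) : Inverted b :=
  mk b (.op f fun i => Function.surjInv (mk_surjective b) (q i))

theorem opInv_mk {n : ℕ} (f : SmoothFun n) (s : Fin n → InvTerm B) :
    opInv b f (fun i => mk b (s i)) = mk b (.op f s) :=
  mk_eq b (.congr f fun _ => mk_exact b (Function.surjInv_eq _ _))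

theorem exists_rep {n : ℕ} (q : Fin n → Inverted b) :
    ∃ s : Fin n → InvTerm B, q = fun i => mk b (s i) :=
  ⟨fun i => Function.surjInv (mk_surjective b) (q i),
    funext fun _ => (Function.surjInv_eq _ _).symm⟩

noncomputable instance instCInftyRing : CInftyRing (Inverted b) :=
  CInftyRing.ofOps (fun f q => opInv b f q)
    (by
      intro n i q
      obtain ⟨s, rfl⟩ := exists_rep b q
      rw [opInv_mk]
      exact mk_eq b (.coord i s))
    (by
      intro n m f g q
      obtain ⟨s, rfl⟩ := exists_rep b q
      simp only [opInv_mk]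
      exact mk_eq b (.comp f g s))

theorem op_mk {n : ℕ} (f : SmoothFun n) (s : Fin n → InvTerm B) :
    op f (fun i => mk b (s i)) = mk b (.op f s) :=
  opInv_mk b f s

end Inverted

/-- A map between `C^∞`-rings commuting with all operations is a morphism. -/
def CInftyHom.ofMapOp {A : Type u} {B : Type v} [CInftyRing A] [CInftyRing B] (φ : A → B)
    (h : ∀ {n : ℕ} (f : SmoothFun n) (a : Fin n → A), φ (op f a) = op f (fun i => φ (a i))) :
    CInftyHom A B where
  toRingHom := RingHom.mk'
    ⟨⟨φ, by
      have h1 := h (1 : SmoothFun 0) ![]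
      rwa [op_one, op_one] at h1⟩,
      fun x y => by
        have h1 := h mulFun ![x, y]
        rw [op_mulFun] at h1
        show φ (x * y) = φ x * φ y
        rw [h1, ← op_mulFun]
        congr 1
        funext i
        fin_cases i <;> rfl⟩
    (fun x y => by
      have h1 := h addFun ![x, y]
      rw [op_addFun] at h1
      show φ (x + y) = φ x + φ y
      rw [h1, ← op_addFun]
      congr 1
      funext i
      fin_cases i <;> rfl)
  map_op f a := h f a

namespace Inverted

variable {B : Type u} [CInftyRing B] (b : B)

/-- The canonical morphism `B → B{b⁻¹}`. -/
noncomputable def ofHom : CInftyHom B (Inverted b) :=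
  CInftyHom.ofMapOp (fun x => mk b (.of x)) (by
    intro n f a
    rw [op_mk]
    exact mk_eq b (.of_op f a))

theorem ofHom_apply (x : B) : (ofHom b).toRingHom x = mk b (.of x) := rfl

theorem ofHom_mul_inv : (ofHom b).toRingHom b * mk b .inv = 1 := by
  rw [← map_one (ofHom b).toRingHom, ofHom_apply, ofHom_apply, ← mk_eq b .mul_inv, ← op_mulFun,
    ← op_mk]
  congr 1
  funext i
  fin_cases i <;> rfl

theorem isUnit_ofHom : IsUnit ((ofHom b).toRingHom b) :=
  IsUnit.of_mul_eq_one _ (ofHom_mul_inv b)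

/-- Evaluation of formal expressions. -/
def termValue {C : Type v} [CInftyRing C] (ψ : B → C) (c : C) : InvTerm B → C
  | .of x => ψ x
  | .inv => c
  | .op f s => op f fun i => termValue ψ c (s i)

theorem value_eq {C : Type v} [CInftyRing C] (ψ : CInftyHom B C) (c : C)
    (hc : ψ.toRingHom b * c = 1) {s t : InvTerm B} (h : InvRel b s t) :
    termValue ψ.toRingHom c s = termValue ψ.toRingHom c t := by
  induction h with
  | refl => rfl
  | symm _ ih => exact ih.symm
  | trans _ _ ih1 ih2 => exact ih1.trans ih2
  | congr f _ ih => simp only [termValue, ih]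
  | coord i s => simp only [termValue, op_coord]
  | comp f g s => simp only [termValue, op_comp]
  | of_op f a => exact ψ.map_op f a
  | mul_inv =>
    simp only [termValue, map_one]
    rw [← hc, ← op_mulFun]
    congr 1
    funext i
    fin_cases i <;> rfl

/-- The universal property of `B{b⁻¹}`. -/
theorem existsUnique_lift {C : Type v} [CInftyRing C] (ψ : CInftyHom B C)
    (hb : IsUnit (ψ.toRingHom b)) :
    ∃! χ : CInftyHom (Inverted b) C, ∀ x, χ.toRingHom ((ofHom b).toRingHom x) = ψ.toRingHom x := by
  obtain ⟨c, hc⟩ := hb.exists_right_inv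
  let χ : Inverted b → C := Quotient.lift (s := invSetoid b) (termValue ψ.toRingHom c)
    (fun _ _ h => value_eq b ψ c hc h)
  have hχ : ∀ s, χ (mk b s) = termValue ψ.toRingHom c s := fun _ => rfl
  refine ⟨CInftyHom.ofMapOp χ ?_, fun _ => rfl, ?_⟩
  · intro n f q
    obtain ⟨s, rfl⟩ := exists_rep b q
    rw [op_mk]
    rfl
  · intro χ' h'
    have hval : ∀ s, χ'.toRingHom (mk b s) = termValue ψ.toRingHom c s := by
      intro s
      induction s with
      | of x => exact h' x
      | inv =>
        have h1 := congrArg χ'.toRingHom (ofHom_mul_inv b)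
        rw [map_mul, map_one, h'] at h1
        exact (hb.mul_right_inj).1 (h1.trans hc.symm)
      | op f s ih =>
        rw [← op_mk]
        refine (χ'.map_op f _).trans ?_
        simp only [termValue]
        congr 1
        funext i
        exact ih i
    obtain ⟨r', m'⟩ := χ'
    have : r' = (CInftyHom.ofMapOp χ (by
        intro n f q
        obtain ⟨s, rfl⟩ := exists_rep b q
        rw [op_mk]
        rfl)).toRingHom := by
      apply RingHom.ext
      intro q
      obtain ⟨s, rfl⟩ := mk_surjective b q
      exact hval s
    subst this
    rfl

end Inverted

/-! ### Radicals, germs and finiteness conditions -/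

section notions

variable {A : Type u} [CInftyRing A]

/-- The `∞`-radical of an ideal `I`: the elements `a` such that the `C^∞`-ring `(A/I){a⁻¹}`
is zero. -/
def inftyRadical (I : Ideal A) : Set A :=
  {a | Subsingleton (Inverted (Ideal.Quotient.mk I a))}

/-- The ideal of elements with vanishing germ at `Spec A'`, for a morphism `φ : A → A'`. -/
def vanishingGerm {A' : Type v} [CInftyRing A'] (φ : CInftyHom A A') : Ideal A where
  carrier := {a | ∃ b, a * b = 0 ∧ IsUnit (φ.toRingHom b)}
  add_mem' := by
    rintro x y ⟨b, hb, ub⟩ ⟨c, hc, uc⟩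
    refine ⟨b * c, ?_, ?_⟩
    · linear_combination c * hb + b * hc
    · rw [map_mul]
      exact ub.mul uc
  zero_mem' := ⟨1, by simp, by simp⟩
  smul_mem' := by
    rintro r x ⟨b, hb, ub⟩
    exact ⟨b, by rw [smul_eq_mul, mul_assoc, hb, mul_zero], ub⟩

variable (A) in
/-- `A` is finitely generated: it is a quotient of some `C^∞(ℝⁿ)`. -/
def IsFinitelyGenerated : Prop :=
  ∃ (n : ℕ) (α : CInftyHom (SmoothFun n) A), Function.Surjective α.toRingHom

variable (A) in
/-- `A` is point-determined: an element that vanishes at all real points `A → ℝ` is zero. -/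
def IsPointDetermined : Prop :=
  ∀ a : A, (∀ p : CInftyHom A ℝ, p.toRingHom a = 0) → a = 0

end notions

end CInfty

namespace CInfty

open SmoothFun CInftyRing Filter Topology

/-! ### Flat functions and lower bounds near a closure -/

/-! The inclusion is a Nakayama-type argument. If `a * b = 0` and `φ b` is inverted by `φ c`, then
`b * c - 1` lies in the kernel of `φ`, hence in the `∞`-radical of `I`. Thus `b * c` generates the
unit ideal modulo `I`, while `a` kills it, so `a ∈ I` (`vanishingGerm_le`).

For equality, each `a` outside the germ ideal needs its own ideal `I` that omits `a` and has the
same `∞`-radical as `K = ker φ`. The radical is unchanged if `I ≤ K` contains `E(k)` for every `k ∈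
K`, where `E ≥ 0` vanishes only at `0`: elements killed by such an `E` lie in the Jacobson radical
(`inftyRadical_eq_of_op_mem`). The freedom is that `E` may be as flat at `0` as desired
(`exists_flat`).

Write `a` as the image of a smooth `F` on `ℝⁿ`, and let `S` be the set of points of `A` where `F ≠
0`. As `a` is not in the germ ideal, every `G` mapping into `K` has a zero `z` in the closure of `S`
(`exists_zero_mem_closure`). Compactness bounds `|F|` from below at points of `S` close to such `z`.
With `E` flatter than this bound, the functions decaying like `E(G)` near the zeros of `G` form an
ideal containing every `E(G)`, and no member of it can agree with `F` on `S`. -/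

theorem exists_smul_iteratedFDeriv_le {g : ℝ → ℝ} (hg : ContDiff ℝ ∞ g)
    (hc : HasCompactSupport g) (n : ℕ) {ε : ℝ} (hε : 0 < ε) :
    ∃ r : ℝ, 0 < r ∧ ∀ i ≤ n, ∀ x, ‖iteratedFDeriv ℝ i (r • g) x‖ ≤ ε := by
  have hb : ∀ i, ∃ R : ℝ, ∀ x, ‖iteratedFDeriv ℝ i g x‖ ≤ R := by
    intro i
    have : BddAbove (Set.range fun x => ‖iteratedFDeriv ℝ i g x‖) := by
      apply (hg.continuous_iteratedFDeriv (mod_cast le_top)).norm.bddAbove_range_of_hasCompactSupport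
      exact (hc.iteratedFDeriv i).comp_left norm_zero
    exact ⟨_, fun x => this.choose_spec ⟨x, rfl⟩⟩
  choose R hR using hb
  have hR0 : ∀ i, 0 ≤ R i := fun i => (norm_nonneg _).trans (hR i 0)
  have hM : 0 < 1 + ∑ i ∈ Finset.range (n + 1), R i := by
    have := Finset.sum_nonneg fun i (_ : i ∈ Finset.range (n + 1)) => hR0 i
    linarith
  refine ⟨ε / (1 + ∑ i ∈ Finset.range (n + 1), R i), div_pos hε hM, fun i hi x => ?_⟩
  rw [iteratedFDeriv_const_smul_apply (hg.contDiffAt.of_le (mod_cast le_top)), norm_smul,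
    Real.norm_of_nonneg (div_pos hε hM).le, div_mul_eq_mul_div, div_le_iff₀ hM]
  have h1 := Finset.single_le_sum (fun i _ => hR0 i) (Finset.mem_range.2 (Nat.lt_succ_of_le hi))
  have h2 := hR i x
  exact mul_le_mul_of_nonneg_left (by linarith) hε.le

/-- There are smooth functions vanishing exactly at `0`, as flat there as prescribed. -/
theorem exists_flat (μ : ℕ → ℝ) (hμ : ∀ j, 0 < μ j) :
    ∃ E : ℝ → ℝ, ContDiff ℝ ∞ E ∧ E 0 = 0 ∧ (∀ t, t ≠ 0 → 0 < E t) ∧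
      ∀ (j : ℕ) (t : ℝ), |t| ≤ 1 / (j + 1) → |E t| ≤ μ j := by
  let U : ℕ → Set ℝ := fun i => {t | 1 / ((i : ℝ) + 1) < |t| ∧ |t| < i + 1}
  have hU : ∀ i, IsOpen (U i) := fun i =>
    (isOpen_lt continuous_const continuous_abs).inter (isOpen_lt continuous_abs continuous_const)
  choose g hgs hg hgr using fun i => (hU i).exists_contDiff_support_eq (n := ⊤)
  have hg0 : ∀ i t, 0 ≤ g i t := fun i t => (hgr i ⟨t, rfl⟩).1
  have hgc : ∀ i, HasCompactSupport (g i) := by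
    intro i
    apply HasCompactSupport.of_support_subset_isCompact (isCompact_closedBall (0 : ℝ) (i + 1))
    rw [hgs i]
    intro t ht
    simpa using ht.2.le
  -- The running minimum of `μ` lets the `i`-th bump respect all the bounds `μ j` with `j ≤ i` at
  -- once.
  let m : ℕ → ℝ := fun i => (Finset.range (i + 1)).inf' ⟨0, by simp⟩ μ
  have hm0 : ∀ i, 0 < m i := fun i => (Finset.lt_inf'_iff _).2 fun j _ => hμ j
  have hmj : ∀ i j, j ≤ i → m i ≤ μ j := fun i j h =>
    Finset.inf'_le _ (Finset.mem_range.2 (Nat.lt_succ_of_le h))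
  have hε : ∀ i, 0 < (1 / 2 / 2 ^ i : ℝ) * min (m i) 1 := fun i =>
    mul_pos (by positivity) (lt_min (hm0 i) one_pos)
  choose r hr0 hr using fun i => exists_smul_iteratedFDeriv_le (hg i) (hgc i) i (hε i)
  have hsum : HasSum (fun i : ℕ => (1 / 2 / 2 ^ i : ℝ)) 1 := hasSum_geometric_two' 1
  have hb : ∀ i t, r i * g i t ≤ (1 / 2 / 2 ^ i : ℝ) * min (m i) 1 := fun i t =>
    (le_abs_self _).trans (by simpa only [norm_iteratedFDeriv_zero] using! hr i 0 (Nat.zero_le _) t)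
  have hb1 : ∀ i t, r i * g i t ≤ (1 / 2 / 2 ^ i : ℝ) := fun i t =>
    (hb i t).trans (mul_le_of_le_one_right (by positivity) (min_le_right _ _))
  have hnn : ∀ i t, 0 ≤ r i * g i t := fun i t => mul_nonneg (hr0 i).le (hg0 i t)
  have hS : ∀ t, Summable fun i => r i * g i t := fun t =>
    Summable.of_nonneg_of_le (fun i => hnn i t) (fun i => hb1 i t) hsum.summable
  refine ⟨fun t => ∑' i, r i * g i t, ?_, ?_, ?_, ?_⟩
  -- The `i`-th bump is controlled in derivatives of order at most `i`, so each fixed order is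
  -- controlled for all but finitely many terms.
  · refine contDiff_tsum_of_eventually (N := ⊤) (f := fun i => r i • g i)
      (fun k => (hg k).const_smul (r k)) (fun k _ => hsum.summable) ?_
    intro i _
    simp only [Nat.cofinite_eq_atTop, Filter.eventually_atTop]
    exact ⟨i, fun n hn x => (hr n i hn x).trans
      (mul_le_of_le_one_right (by positivity) (min_le_right _ _))⟩
  · have : ∀ i, g i 0 = 0 := by
      intro i
      rw [← Function.notMem_support, hgs i]
      simp only [U, Set.mem_ofPred_eq, abs_zero, not_and]
      intro h
      have : (0 : ℝ) < 1 / ((i : ℝ) + 1) := by positivity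
      linarith
    simp [this]
  · intro t ht
    have ht' : 0 < |t| := abs_pos.2 ht
    obtain ⟨i, hi⟩ := exists_nat_gt (max |t| (1 / |t|))
    have hi1 : |t| < i := (le_max_left _ _).trans_lt hi
    have hi2 : 1 / |t| < i := (le_max_right _ _).trans_lt hi
    have hmem : t ∈ Function.support (g i) := by
      rw [hgs i]
      refine ⟨?_, by linarith⟩
      rw [div_lt_comm₀ (by positivity) ht']
      linarith
    exact (hS t).tsum_pos (fun i => hnn i t) i
      (mul_pos (hr0 i) (lt_of_le_of_ne (hg0 i t) (Ne.symm hmem)))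
  · intro j t ht
    rw [abs_of_nonneg (tsum_nonneg fun i => hnn i t)]
    have hle : ∀ i, r i * g i t ≤ (1 / 2 / 2 ^ i : ℝ) * μ j := by
      intro i
      by_cases h : j ≤ i
      · exact (hb i t).trans (mul_le_mul_of_nonneg_left ((min_le_left _ _).trans (hmj i j h))
          (by positivity))
      · have : g i t = 0 := by
          rw [← Function.notMem_support, hgs i]
          intro hmem
          have h1 : (1 : ℝ) / (j + 1) ≤ 1 / (i + 1) := by
            have : (i : ℝ) ≤ j := by exact_mod_cast (not_le.1 h).le
            gcongr
          have h2 := hmem.1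
          linarith
        rw [this, mul_zero]
        have := hμ j
        positivity
    have h1 := (hS t).tsum_le_tsum hle (hsum.mul_right (μ j)).summable
    rwa [(hsum.mul_right (μ j)).tsum_eq, one_mul] at h1

/-- A point of `S` within `δ / 2` of `z` serves every point of the ball of radius `δ / 2` around
`z`; compactness leaves finitely many such points, and `η` is the least of their values `|f s|`. -/
theorem exists_lower_bound_near_closure {X : Type*} [PseudoMetricSpace X] {S K : Set X}
    (hK : IsCompact K) (hKS : K ⊆ closure S) (f : X → ℝ) (hf : ∀ s ∈ S, f s ≠ 0)
    {δ : ℝ} (hδ : 0 < δ) :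
    ∃ η : ℝ, 0 < η ∧ ∀ z ∈ K, ∃ s ∈ S, dist s z ≤ δ ∧ η ≤ |f s| := by
  refine hK.induction_on ⟨1, one_pos, by simp⟩ ?_ ?_ ?_
  · rintro s t hst ⟨η, h0, h⟩
    exact ⟨η, h0, fun z hz => h z (hst hz)⟩
  · rintro s t ⟨η, h0, h⟩ ⟨η', h0', h'⟩
    refine ⟨min η η', lt_min h0 h0', ?_⟩
    rintro z (hz | hz)
    · obtain ⟨s, hs, hd, he⟩ := h z hz
      exact ⟨s, hs, hd, (min_le_left _ _).trans he⟩
    · obtain ⟨s, hs, hd, he⟩ := h' z hz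
      exact ⟨s, hs, hd, (min_le_right _ _).trans he⟩
  · intro z hz
    obtain ⟨s, hs, hd⟩ := Metric.mem_closure_iff.1 (hKS hz) (δ / 2) (half_pos hδ)
    refine ⟨Metric.ball z (δ / 2), mem_nhdsWithin_of_mem_nhds (Metric.ball_mem_nhds _ (half_pos hδ)),
      |f s|, abs_pos.2 (hf s hs), fun w hw => ⟨s, hs, ?_, le_rfl⟩⟩
    have h1 := dist_triangle s z w
    have h2 : dist w z < δ / 2 := hw
    rw [dist_comm] at hd h2
    linarith

/-! ### The `∞`-radical and the Jacobson radical -/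

/-- The composite of two morphisms of `C^∞`-rings. -/
def CInftyHom.trans {A B C : Type*} [CInftyRing A] [CInftyRing B] [CInftyRing C]
    (φ : CInftyHom A B) (ψ : CInftyHom B C) : CInftyHom A C where
  toRingHom := ψ.toRingHom.comp φ.toRingHom
  map_op f a := (congrArg ψ.toRingHom (φ.map_op f a)).trans (ψ.map_op f _)

/-- The quotient map as a morphism of `C^∞`-rings. -/
noncomputable def quotientHom {A : Type u} [CInftyRing A] (I : Ideal A) : CInftyHom A (A ⧸ I) where
  toRingHom := Ideal.Quotient.mk I
  map_op f a := (op_mk I f a).symm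

/-- The morphism induced on a quotient. -/
noncomputable def CInftyHom.quotientLift {A : Type u} {B : Type v} [CInftyRing A] [CInftyRing B]
    (I : Ideal A) (ψ : CInftyHom A B) (h : ∀ x ∈ I, ψ.toRingHom x = 0) : CInftyHom (A ⧸ I) B where
  toRingHom := Ideal.Quotient.lift I ψ.toRingHom h
  map_op f a := by
    obtain ⟨b, rfl⟩ := exists_rep I a
    rw [op_mk]
    exact ψ.map_op f b

/-- The universal properties of the quotient and of inversion, combined; later arguments use this
form and never the term model of `Inverted`. -/
theorem mem_inftyRadical_iff {A : Type u} [CInftyRing A] {I : Ideal A} {a : A} :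
    a ∈ inftyRadical I ↔ ∀ (D : Type u) [CInftyRing D] (ψ : CInftyHom A D),
      (∀ x ∈ I, ψ.toRingHom x = 0) → IsUnit (ψ.toRingHom a) → Subsingleton D := by
  constructor
  · intro h D _ ψ hI ha
    obtain ⟨χ, -, -⟩ := Inverted.existsUnique_lift (Ideal.Quotient.mk I a) (ψ.quotientLift I hI) ha
    have : Subsingleton (Inverted (Ideal.Quotient.mk I a)) := h
    apply subsingleton_of_zero_eq_one
    rw [← map_zero χ.toRingHom, ← map_one χ.toRingHom]
    exact congrArg _ (Subsingleton.elim _ _)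
  · intro h
    refine h _ ((quotientHom I).trans (Inverted.ofHom _)) (fun x hx => ?_) (Inverted.isUnit_ofHom _)
    have : (quotientHom I).toRingHom x = 0 := Ideal.Quotient.eq_zero_iff_mem.2 hx
    exact (congrArg (Inverted.ofHom (Ideal.Quotient.mk I a)).toRingHom this).trans (map_zero _)

theorem inftyRadical_mono {A : Type u} [CInftyRing A] {I K : Ideal A} (h : I ≤ K) :
    inftyRadical I ⊆ inftyRadical K := fun _ ha =>
  mem_inftyRadical_iff.2 fun D _ ψ hψ => mem_inftyRadical_iff.1 ha D ψ fun x hx => hψ x (h hx)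

theorem subset_inftyRadical {A : Type u} [CInftyRing A] (I : Ideal A) :
    (I : Set A) ⊆ inftyRadical I := fun a ha =>
  mem_inftyRadical_iff.2 fun D _ ψ hψ hu => by
    rw [hψ a ha] at hu
    exact subsingleton_of_zero_eq_one (isUnit_zero_iff.1 hu)

/-- Modulo `I`, elements of the `∞`-radical are quasi-regular. -/
theorem sup_span_one_add_eq_top {A : Type u} [CInftyRing A] {I : Ideal A} {k : A}
    (hk : k ∈ inftyRadical I) : I ⊔ Ideal.span {1 + k} = ⊤ := by
  set L := I ⊔ Ideal.span {1 + k}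
  rw [← Ideal.Quotient.subsingleton_iff]
  -- In `A ⧸ L` the image of `k` is the unit `-1`, so this quotient of `A ⧸ I` must vanish.
  refine mem_inftyRadical_iff.1 hk _ (quotientHom L)
    (fun x hx => Ideal.Quotient.eq_zero_iff_mem.2 (Ideal.mem_sup_left hx)) ?_
  have h : Ideal.Quotient.mk L (1 + k) = 0 :=
    Ideal.Quotient.eq_zero_iff_mem.2 (Ideal.mem_sup_right (Ideal.subset_span rfl))
  have h' : Ideal.Quotient.mk L k = -1 := by
    rw [map_add, map_one] at h
    linear_combination h
  show IsUnit (Ideal.Quotient.mk L k)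
  rw [h']
  exact isUnit_one.neg

theorem SmoothFun.isUnit_of_forall_ne_zero {n : ℕ} (f : SmoothFun n) (h : ∀ x, f.1 x ≠ 0) :
    IsUnit f :=
  IsUnit.of_mul_eq_one ⟨fun x => (f.1 x)⁻¹, f.contDiff.inv h⟩
    (Subtype.ext (funext fun x => mul_inv_cancel₀ (h x)))

/-- A smooth function of one real variable, as an element of `C^∞(ℝ¹)`. -/
def SmoothFun.ofReal (E : ℝ → ℝ) (hE : ContDiff ℝ ∞ E) : SmoothFun 1 :=
  ⟨fun x => E (x 0), hE.comp (contDiff_apply ℝ ℝ 0)⟩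

/-- The function `(s t + 1)² + E(s)` has no zero on `ℝ²`: it is `1` where `s = 0`, and `E(s) > 0`
elsewhere. Hence it is a unit, and its value at `(x, y)`, which is `(x y + 1)²` because `E(x) = 0`,
is a unit for every `y`. -/
theorem mem_jacobson_of_op_eq_zero {D : Type u} [CInftyRing D] {E : ℝ → ℝ} (hE : ContDiff ℝ ∞ E)
    (h0 : E 0 = 0) (hpos : ∀ t, t ≠ 0 → 0 < E t) {x : D} (hx : op (ofReal E hE) ![x] = 0) :
    x ∈ Ideal.jacobson (⊥ : Ideal D) := by
  rw [Ideal.mem_jacobson_bot]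
  intro y
  let F : SmoothFun 2 := (coord 0 * coord 1 + 1) ^ 2 + (ofReal E hE).comp ![coord 0]
  have hF : IsUnit F := by
    apply isUnit_of_forall_ne_zero
    intro z
    show (z 0 * z 1 + 1) ^ 2 + E (z 0) ≠ 0
    by_cases hz : z 0 = 0
    · simp [hz, h0]
    · have := hpos _ hz
      positivity
  have h1 := hF.map (opHom ![x, y])
  have h2 : op ((ofReal E hE).comp ![coord 0]) ![x, y] = 0 := by
    rw [op_comp, ← hx]
    congr 1
    funext i
    fin_cases i
    exact op_coord 0 ![x, y]
  simp only [F, map_add, map_pow, map_mul, map_one, opHom_apply, op_coord, h2, add_zero] at h1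
  exact (isUnit_pow_iff two_ne_zero).1 h1

/-- An ideal between `{E(k) | k ∈ K}` and `K`, with `E` vanishing exactly at `0`, has the same
`∞`-radical as `K`. -/
theorem inftyRadical_eq_of_op_mem {A : Type u} [CInftyRing A] {I K : Ideal A} (hIK : I ≤ K)
    {E : ℝ → ℝ} (hE : ContDiff ℝ ∞ E) (h0 : E 0 = 0) (hpos : ∀ t, t ≠ 0 → 0 < E t)
    (h : ∀ k ∈ K, op (ofReal E hE) ![k] ∈ I) : inftyRadical I = inftyRadical K := by
  refine (inftyRadical_mono hIK).antisymm fun a ha => mem_inftyRadical_iff.2 fun D _ ψ hψ hu => ?_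
  have hsub := mem_inftyRadical_iff.1 ha _ (ψ.trans (quotientHom (K.map ψ.toRingHom)))
    (fun x hx => Ideal.Quotient.eq_zero_iff_mem.2 (Ideal.mem_map_of_mem _ hx))
    (hu.map (Ideal.Quotient.mk _))
  rw [Ideal.Quotient.subsingleton_iff] at hsub
  -- The extension of `K` to `D` is the unit ideal by `hsub`. It also lies in the Jacobson radical,
  -- because `E(ψ k) = ψ(E(k)) = 0`; so `D` is zero.
  have hle : K.map ψ.toRingHom ≤ Ideal.jacobson ⊥ := by
    rw [Ideal.map_le_iff_le_comap]
    intro k hk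
    refine mem_jacobson_of_op_eq_zero hE h0 hpos ?_
    rw [← hψ _ (h k hk)]
    refine Eq.trans ?_ (ψ.map_op _ _).symm
    congr 1
    funext i
    fin_cases i
    rfl
  rw [hsub, top_le_iff, Ideal.jacobson_eq_top_iff] at hle
  exact subsingleton_of_zero_eq_one ((Ideal.mem_bot.1 (hle ▸ Submodule.mem_top : (1 : D) ∈ (⊥ : Ideal D))).symm)

theorem vanishingGerm_le {A : Type u} {A' : Type v} [CInftyRing A] [CInftyRing A']
    (φ : CInftyHom A A') (hφ : Function.Surjective φ.toRingHom) {I : Ideal A}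
    (hI : inftyRadical I = inftyRadical (RingHom.ker φ.toRingHom)) : vanishingGerm φ ≤ I := by
  rintro a ⟨b, hab, hb⟩
  obtain ⟨c', hc'⟩ := hb.exists_right_inv
  obtain ⟨c, rfl⟩ := hφ c'
  have hk : b * c - 1 ∈ inftyRadical I := by
    rw [hI]
    apply subset_inftyRadical
    simp [RingHom.mem_ker, hc']
  have h1 := sup_span_one_add_eq_top hk
  rw [add_sub_cancel, Ideal.eq_top_iff_one, Submodule.mem_sup] at h1
  obtain ⟨i, hi, s, hs, his⟩ := h1
  obtain ⟨r, rfl⟩ := Ideal.mem_span_singleton'.1 hs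
  have : a = a * i := by linear_combination -a * his + r * c * hab
  rw [this]
  exact I.mul_mem_left _ hi

/-! ### Quotients of `C^∞(ℝⁿ)` -/

/-- Every morphism `C^∞(ℝⁿ) → ℝ` is evaluation at a point. -/
theorem hom_real_apply {n : ℕ} (p : CInftyHom (SmoothFun n) ℝ) (f : SmoothFun n) :
    p.toRingHom f = f.1 fun i => p.toRingHom (coord i) :=
  p.map_op f coord

/-- The zero set of the kernel of a morphism from `C^∞(ℝⁿ)`. -/
def kernelZeros {A : Type u} [CInftyRing A] {n : ℕ} (α : CInftyHom (SmoothFun n) A) :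
    Set (Fin n → ℝ) :=
  {x | ∀ k : SmoothFun n, α.toRingHom k = 0 → k.1 x = 0}

/-- Real points of `A` pull back along `α` to evaluations at points of `kernelZeros α`. -/
theorem map_eq_zero_of_isPointDetermined {A : Type u} [CInftyRing A] (hA : IsPointDetermined A)
    {n : ℕ} (α : CInftyHom (SmoothFun n) A) {h : SmoothFun n}
    (hh : ∀ x ∈ kernelZeros α, h.1 x = 0) : α.toRingHom h = 0 := by
  refine hA _ fun p => ?_
  refine (hom_real_apply (α.trans p) h).trans (hh _ fun k hk => ?_)
  rw [← hom_real_apply (α.trans p) k]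
  exact (congrArg p.toRingHom hk).trans (map_zero _)

/-- Otherwise let `H` vanish exactly on the closure. Then `F * H` vanishes on `kernelZeros α`, so
its image in `A` is zero, while `H ^ 2 + G ^ 2` has no zero and is a unit. Since `G` dies in `A'`,
the image of `H` is invertible there, and `H` witnesses that `F` lies in the germ ideal. -/
theorem exists_zero_mem_closure {A : Type u} {A' : Type v} [CInftyRing A] [CInftyRing A']
    (hA : IsPointDetermined A) (φ : CInftyHom A A') {n : ℕ} (α : CInftyHom (SmoothFun n) A)
    {F : SmoothFun n} (hF : α.toRingHom F ∉ vanishingGerm φ) {G : SmoothFun n}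
    (hG : φ.toRingHom (α.toRingHom G) = 0) :
    ∃ z, G.1 z = 0 ∧ z ∈ closure {x | x ∈ kernelZeros α ∧ F.1 x ≠ 0} := by
  by_contra! hcon
  obtain ⟨h, hs, hsm, -⟩ := (isClosed_closure
    (s := {x | x ∈ kernelZeros α ∧ F.1 x ≠ 0})).isOpen_compl.exists_contDiff_support_eq (n := ⊤)
  have hz : ∀ x, h x = 0 ↔ x ∈ closure {x | x ∈ kernelZeros α ∧ F.1 x ≠ 0} := by
    intro x
    rw [← Function.notMem_support, hs, Set.notMem_compl_iff]
  let H : SmoothFun n := ⟨h, hsm⟩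
  refine hF ⟨α.toRingHom H, ?_, ?_⟩
  · rw [← map_mul]
    refine map_eq_zero_of_isPointDetermined hA α fun x hx => ?_
    show F.1 x * h x = 0
    by_cases hFx : F.1 x = 0
    · rw [hFx, zero_mul]
    · rw [(hz x).2 (subset_closure ⟨hx, hFx⟩), mul_zero]
  · have hu : IsUnit (H ^ 2 + G ^ 2) := by
      apply isUnit_of_forall_ne_zero
      intro x hx
      have hx' : h x ^ 2 + G.1 x ^ 2 = 0 := hx
      have h1 : h x = 0 := by nlinarith [sq_nonneg (h x), sq_nonneg (G.1 x)]
      have h2 : G.1 x = 0 := by nlinarith [sq_nonneg (h x), sq_nonneg (G.1 x)]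
      exact hcon x h2 ((hz x).1 h1)
    have := (hu.map α.toRingHom).map φ.toRingHom
    simp only [map_add, map_pow, hG] at this
    rw [zero_pow two_ne_zero, add_zero] at this
    exact (isUnit_pow_iff two_ne_zero).1 this

/-- Functions decaying at rate `μ` at all zeros of some element of `J`. -/
def decayIdeal {n : ℕ} (J : Ideal (SmoothFun n)) (μ : ℕ → ℝ) :
    Ideal (SmoothFun n) where
  carrier := {H | ∃ G ∈ J, ∀ z, G.1 z = 0 → ∃ C : ℝ, ∀ᶠ j : ℕ in atTop,
    ∀ s, dist s z ≤ 1 / ((j : ℝ) + 1) ^ 2 → |H.1 s| ≤ C * μ j}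
  zero_mem' := ⟨0, J.zero_mem, fun z _ => ⟨0, by simp⟩⟩
  add_mem' := by
    rintro H H' ⟨G, hG, h⟩ ⟨G', hG', h'⟩
    -- The zeros of a sum of squares are the common zeros, where both decay estimates hold.
    refine ⟨G * G + G' * G', J.add_mem (J.mul_mem_left _ hG) (J.mul_mem_left _ hG'), ?_⟩
    intro z hz
    have hz' : G.1 z * G.1 z + G'.1 z * G'.1 z = 0 := hz
    obtain ⟨h1, h2⟩ := (mul_self_add_mul_self_eq_zero).1 hz'
    obtain ⟨C, hC⟩ := h z h1
    obtain ⟨C', hC'⟩ := h' z h2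
    refine ⟨C + C', ?_⟩
    filter_upwards [hC, hC'] with j hj hj' s hs
    rw [add_mul]
    exact (abs_add_le _ _).trans (add_le_add (hj s hs) (hj' s hs))
  smul_mem' := by
    rintro U H ⟨G, hG, h⟩
    refine ⟨G, hG, fun z hz => ?_⟩
    obtain ⟨C, hC⟩ := h z hz
    obtain ⟨M, hM⟩ := (isCompact_closedBall z 1).exists_bound_of_continuousOn
      U.contDiff.continuous.continuousOn
    refine ⟨M * C, ?_⟩
    filter_upwards [hC] with j hj s hs
    have hs1 : dist s z ≤ 1 := hs.trans (by
      rw [div_le_one (by positivity)]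
      have : (0 : ℝ) ≤ j := by positivity
      nlinarith)
    have h1 := hM s hs1
    have h2 := hj s hs
    show |U.1 s * H.1 s| ≤ _
    rw [abs_mul, mul_assoc]
    exact mul_le_mul h1 h2 (abs_nonneg _) ((norm_nonneg _).trans h1)

/-- Near a zero `z`, `G` is Lipschitz with some constant `K`, so `|G s| ≤ K / (j + 1) ^ 2 ≤ 1 / (j +
1)` on the ball of radius `1 / (j + 1) ^ 2` once `j + 1 ≥ K`. The squared radius thus absorbs a
constant that depends on `G` and `z`. -/
theorem comp_flat_mem_decayIdeal {n : ℕ} {J : Ideal (SmoothFun n)} {μ : ℕ → ℝ}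
    {E : ℝ → ℝ} (hE : ContDiff ℝ ∞ E)
    (hflat : ∀ (j : ℕ) (t : ℝ), |t| ≤ 1 / (j + 1) → |E t| ≤ μ j) {G : SmoothFun n} (hG : G ∈ J) :
    (ofReal E hE).comp ![G] ∈ decayIdeal J μ := by
  refine ⟨G, hG, fun z hz => ⟨1, ?_⟩⟩
  obtain ⟨K, t, ht, hK⟩ := (G.contDiff.contDiffAt (x := z)).of_le
    (show (1 : WithTop ℕ∞) ≤ ∞ by simp) |>.exists_lipschitzOnWith
  obtain ⟨r, hr, hball⟩ := Metric.mem_nhds_iff.1 ht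
  obtain ⟨N, hN⟩ := exists_nat_gt (max (K : ℝ) (1 / r))
  filter_upwards [eventually_ge_atTop N] with j hj s hs
  have hj' : (N : ℝ) ≤ j := by exact_mod_cast hj
  have hKj : (K : ℝ) ≤ j + 1 := by linarith [le_max_left (K : ℝ) (1 / r)]
  have hrj : 1 / r < j + 1 := by linarith [le_max_right (K : ℝ) (1 / r)]
  have hj0 : (0 : ℝ) < j + 1 := by positivity
  have hs1 : dist s z ≤ 1 / ((j : ℝ) + 1) * (1 / (j + 1)) := hs.trans_eq (by field_simp)
  have hj1 : 1 / ((j : ℝ) + 1) ≤ 1 := by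
    rw [div_le_one hj0]
    linarith [show (0 : ℝ) ≤ j by positivity]
  have hst : s ∈ t := by
    apply hball
    rw [div_lt_comm₀ hr hj0] at hrj
    have h0 : 0 ≤ 1 / ((j : ℝ) + 1) := by positivity
    exact lt_of_le_of_lt (hs1.trans (mul_le_of_le_one_left h0 hj1)) hrj
  rw [one_mul]
  apply hflat
  have h1 := hK.dist_le_mul s hst z (mem_of_mem_nhds ht)
  rw [Real.dist_eq, hz, sub_zero] at h1
  refine h1.trans ((mul_le_mul hKj hs1 dist_nonneg hj0.le).trans_eq ?_)
  field_simp

theorem op_ofReal_mem {A : Type u} [CInftyRing A] (I : Ideal A) {E : ℝ → ℝ}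
    (hE : ContDiff ℝ ∞ E) (h0 : E 0 = 0) {k : A} (hk : k ∈ I) : op (ofReal E hE) ![k] ∈ I := by
  have h1 := op_sub_mem I (ofReal E hE) ![k] ![0] (by
    intro i
    fin_cases i
    simpa using hk)
  have h2 : op (ofReal E hE) ![(0 : A)] = 0 := by
    -- `E(0) = 0` passes from `ℝ` to `A` through the nullary operations.
    have h3 : (ofReal E hE).comp ![0] = (0 : SmoothFun 0) := Subtype.ext (funext fun _ => h0)
    have h4 := op_comp (ofReal E hE) ![0] (![] : Fin 0 → A)
    rw [h3, ← opHom_apply, map_zero] at h4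
    refine Eq.trans ?_ h4.symm
    congr 1
    funext i
    fin_cases i
    exact (map_zero (opHom (![] : Fin 0 → A))).symm
  rwa [h2, sub_zero] at h1

theorem exists_ideal_notMem {A : Type u} {A' : Type v} [CInftyRing A] [CInftyRing A']
    (φ : CInftyHom A A') (hfg : IsFinitelyGenerated A) (hpd : IsPointDetermined A) {a : A}
    (ha : a ∉ vanishingGerm φ) :
    ∃ I : Ideal A, inftyRadical I = inftyRadical (RingHom.ker φ.toRingHom) ∧ a ∉ I := by
  obtain ⟨n, α, hα⟩ := hfg
  obtain ⟨F, rfl⟩ := hα a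
  let S : Set (Fin n → ℝ) := {x | x ∈ kernelZeros α ∧ F.1 x ≠ 0}
  let J : Ideal (SmoothFun n) := (RingHom.ker φ.toRingHom).comap α.toRingHom
  -- The flatness of `E` must be fixed before `G` and `z` are known, so the bounds are uniform on
  -- balls of radius `j`; a given `z` is covered for all large `j`.
  choose η hη0 hη using fun j : ℕ => exists_lower_bound_near_closure (S := S)
    (((isCompact_closedBall (0 : Fin n → ℝ) j).inter_right isClosed_closure))
    Set.inter_subset_right F.1 (fun s hs => hs.2) (δ := 1 / ((j : ℝ) + 1) ^ 2) (by positivity)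
  -- The extra factor `1 / (j + 1)` will beat the unknown constant `C` of the decay estimate.
  have hμ : ∀ j : ℕ, 0 < η j / (j + 1) := fun j => div_pos (hη0 j) (by positivity)
  obtain ⟨E, hE, h0, hpos, hflat⟩ := exists_flat _ hμ
  -- Intersecting with `J` keeps the image inside the kernel of `φ`, and `E(G)` still belongs to it
  -- for every `G ∈ J`.
  refine ⟨((decayIdeal J fun j => η j / (j + 1)) ⊓ J).map α.toRingHom, ?_, ?_⟩
  · apply inftyRadical_eq_of_op_mem _ hE h0 hpos
    · intro k hk
      obtain ⟨G, rfl⟩ := hα k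
      have : op (ofReal E hE) ![α.toRingHom G] = α.toRingHom ((ofReal E hE).comp ![G]) := by
        refine Eq.trans ?_ (α.map_op (ofReal E hE) ![G]).symm
        congr 1
        funext i
        fin_cases i
        rfl
      rw [this]
      exact Ideal.mem_map_of_mem _ ⟨comp_flat_mem_decayIdeal hE hflat hk, op_ofReal_mem J hE h0 hk⟩
    · exact Ideal.map_le_iff_le_comap.2 inf_le_right
  · intro hmem
    obtain ⟨H, ⟨⟨G, hG, hH⟩, -⟩, hHF⟩ := (Ideal.mem_map_iff_of_surjective _ hα).1 hmem
    obtain ⟨z, hz, hzS⟩ := exists_zero_mem_closure hpd φ α ha hG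
    obtain ⟨C, hC⟩ := hH z hz
    obtain ⟨N, hN⟩ := exists_nat_gt (max C ‖z‖)
    obtain ⟨j, hj, hNj⟩ := (hC.and (eventually_ge_atTop N)).exists
    have hNj' : (N : ℝ) ≤ j := by exact_mod_cast hNj
    have hCj : C < j := by linarith [le_max_left C ‖z‖]
    have hzj : ‖z‖ ≤ j := by linarith [le_max_right C ‖z‖]
    obtain ⟨s, hs, hd, hle⟩ := hη j z ⟨by simpa using hzj, hzS⟩
    have hFs : F.1 s = H.1 s := by
      have h1 : F.1 s - H.1 s = 0 := hs.1 (F - H) (by rw [map_sub, hHF, sub_self])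
      linarith
    -- As `F` and `H` agree at `s`, this gives `(j + 1) |F s| ≤ C * η j`, contradicting `η j ≤ |F
    -- s|` and `C < j`.
    have h1 := hj s hd
    rw [← hFs, ← mul_div_assoc, le_div_iff₀ (by positivity)] at h1
    nlinarith [hη0 j, abs_nonneg (F.1 s), show (0 : ℝ) ≤ j by positivity]

end CInfty

theorem mainTheorem3 {A : Type u} {A' : Type v} [CInfty.CInftyRing A] [CInfty.CInftyRing A']
    (φ : CInfty.CInftyHom A A') (hφ : Function.Surjective φ.toRingHom) :
    (CInfty.vanishingGerm φ ≤
      sInf {I : Ideal A |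
        CInfty.inftyRadical I = CInfty.inftyRadical (RingHom.ker φ.toRingHom)}) ∧
    (CInfty.IsFinitelyGenerated A → CInfty.IsPointDetermined A →
      CInfty.vanishingGerm φ =
        sInf {I : Ideal A |
          CInfty.inftyRadical I = CInfty.inftyRadical (RingHom.ker φ.toRingHom)}) := by
  have hle := le_sInf fun I hI => CInfty.vanishingGerm_le φ hφ (I := I) hI
  refine ⟨hle, fun hfg hpd => le_antisymm hle fun a ha => ?_⟩
  by_contra hna
  obtain ⟨I, hI, haI⟩ := CInfty.exists_ideal_notMem φ hfg hpd hna
  exact haI (Ideal.mem_sInf.1 ha hI)
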